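/- Let $k$ be a perfect field of prime characteristic $p$, let $n\ge 1$, let $R=k[[X_1,\dots,X_{n+1}]]$ with maximal ideal $\mathfrak m$, and let $0\ne f\in\mathfrak m$. For an ideal $I$ of a ring of characteristic $p$ write $I^{[p^e]}$ for the ideal generated by the $p^e$-th powers of the elements of $I$. For integers $e,t\ge 0$ put $$M_{e,t}=\frac{(f^t)+\mathfrak m^{[p^e]}}{(f^{t+1})+\mathfrak m^{[p^e]}},\qquad C_{e,t}=\frac{\ell_R(M_{e,t})}{p^{en}},$$ where $\ell_R$ denotes length as an $R$-module. For $x\in[0,1]$ put $\xi_{f,e}(x)=C_{e,\lfloor xp^e\rfloor}$ if $x<1$ and $\xi_{f,e}(1)=C_{e,p^e-1}$, and define $$\xi_f(x)=\limsup_{e\to\infty}\xi_{f,e}(x),\qquad \varphi_f(x)=\int_0^x\xi_f(t)\,dt\qquad(x\in[0,1]).$$ For a $d$-dimensional Noetherian local ring $(A,\mathfrak n)$ of characteristic $p$ let $e_{HK}(A)=\lim_{e\to\infty}\ell_A(A/\mathfrak n^{[p^e]})/p^{ed}$ be its Hilbert--Kunz multiplicity. Then these objects are well defined (each $\ell_R(M_{e,t})$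 is finite, $(\xi_{f,e}(x))_e$ is bounded above for every $x\in[0,1]$, $\xi_f$ is integrable on $[0,1]$, and the limit defining $e_{HK}(R/(f))$ exists), and, with derivatives at the endpoints of $[0,1]$ understood as one-sided: 1) $\varphi_f$ is differentiable at $0$, and $\varphi_f'(0)=\xi_f(0)=\lim_{e\to\infty}C_{e,0}=e_{HK}(R/(f))$. 2) $\varphi_f$ is differentiable at $1$, and $\varphi_f'(1)=\xi_f(1)=\lim_{e\to\infty}C_{e,p^e-1}$. -/

import Mathlib

open Filter Topology MeasureTheory Set

noncomputable section

namespace HypersurfaceXi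

/-- The ideal `I^[q]` generated by the `q`-th powers of all elements of `I`
(used with `q = p ^ e`). -/
def frobeniusPower {R : Type*} [CommRing R] (I : Ideal R) (q : ℕ) : Ideal R :=
  Ideal.span ((fun x : R => x ^ q) '' (I : Set R))

/-- The Krull dimension of a ring, as a natural number. -/
def krullDimNat (A : Type*) [CommRing A] : ℕ :=
  (WithBot.unbotD 0 (ringKrullDim A)).toNat

/-- `ℓ(A / 𝔫^[p^e]) / p^(e d)` for a `d`-dimensional local ring `(A, 𝔫)`. -/
def hilbertKunzRatio (p : ℕ) (A : Type*) [CommRing A] [IsLocalRing A] (e : ℕ) : ℝ :=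
  ((Module.length A (A ⧸ frobeniusPower (IsLocalRing.maximalIdeal A) (p ^ e))).toNat : ℝ) /
    (p : ℝ) ^ (e * krullDimNat A)

/-- The Hilbert-Kunz multiplicity `e_HK(A)` of a local ring of characteristic `p`. -/
def hilbertKunzMultiplicity (p : ℕ) (A : Type*) [CommRing A] [IsLocalRing A] : ℝ :=
  limUnder atTop (hilbertKunzRatio p A)

section

variable {R : Type*} [CommRing R] [IsLocalRing R]

/-- The ideal `(f^t) + 𝔪^[p^e]`. -/
def powIdeal (p : ℕ) (f : R) (e t : ℕ) : Ideal R :=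
  Ideal.span {f ^ t} ⊔ frobeniusPower (IsLocalRing.maximalIdeal R) (p ^ e)

/-- The `R`-module `M_{e,t} = ((f^t) + 𝔪^[p^e]) / ((f^(t+1)) + 𝔪^[p^e])`. -/
abbrev M (p : ℕ) (f : R) (e t : ℕ) : Type _ :=
  (powIdeal p f e t) ⧸ (powIdeal p f e (t + 1)).submoduleOf (powIdeal p f e t)

/-- `C_{e,t} = ℓ_R(M_{e,t}) / p^(e n)`. -/
def C (p n : ℕ) (f : R) (e t : ℕ) : ℝ :=
  ((Module.length R (M p f e t)).toNat : ℝ) / (p : ℝ) ^ (e * n)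

/-- The step function `ξ_{f,e}`; only its values on `[0,1]` are meaningful. -/
def xiStep (p n : ℕ) (f : R) (e : ℕ) (x : ℝ) : ℝ :=
  if x < 1 then C p n f e ⌊x * (p : ℝ) ^ e⌋₊ else C p n f e (p ^ e - 1)

/-- `ξ_f(x) = limsup_e ξ_{f,e}(x)`; only its values on `[0,1]` are meaningful. -/
def xi (p n : ℕ) (f : R) (x : ℝ) : ℝ :=
  limsup (fun e : ℕ => xiStep p n f e x) atTop

/-- `φ_f(x) = ∫_0^x ξ_f(t) dt`. -/
def phi (p n : ℕ) (f : R) (x : ℝ) : ℝ :=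
  ∫ t in (0 : ℝ)..x, xi p n f t

/-- If `f` lies in the maximal ideal of a local ring `R`, then `R/(f)` is a local ring. -/
theorem isLocalRing_quotient {f : R} (hf : f ∈ IsLocalRing.maximalIdeal R) :
    IsLocalRing (R ⧸ Ideal.span {f}) := by
  haveI : Nontrivial (R ⧸ Ideal.span {f}) := by
    rw [Ideal.Quotient.nontrivial_iff, Ne, Ideal.span_singleton_eq_top]
    exact hf
  exact IsLocalRing.of_surjective' (Ideal.Quotient.mk (Ideal.span {f}))
    Ideal.Quotient.mk_surjective

end

end HypersurfaceXi

end

/-! Everything rests on one self-similarity. Since k is perfect, R is free over its subring of p-th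
powers on the monomials X^a with 0 ≤ a_i < p, so dim_k R/I^[p] = p^(n+1) dim_k R/I when R/I is
finite-dimensional (`finrank_quotient_map_frobenius`). Frobenius sends (f^t) + 𝔪^[p^e] to generators
of (f^(pt)) + 𝔪^[p^(e+1)], and telescoping makes C_{e,t} the mean of the p numbers C_{e+1,pt+s}, 0 ≤
s < p (`sum_C`). Multiplication by f maps M_{e,t} onto M_{e,t+1}, so C_{e,t} is nonincreasing in t,
and a count of lexicographic leading terms bounds C_{e,0} uniformly in e (`exists_finrank_le`).

The rest is real analysis of such arrays (`IsSlopeSequence`). Averaging makes C_{e,0} nondecreasing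
and C_{e,p^e-1} nonincreasing in e, so both converge; it also forces the neighbours C_{e,1} and
C_{e,p^e-2} to the same limits (`tendsto_second`, `tendsto_penultimate`). These neighbours bound ξ_f
near the endpoints, so the monotone function ξ_f is continuous there from within [0,1], and the
fundamental theorem of calculus gives the derivatives. Finally M_{e,0} ≅ R/((f) + 𝔪^[p^e]), so
C_{e,0} is the Hilbert-Kunz ratio of the n-dimensional ring R/(f). -/

noncomputable section

namespace HypersurfaceXi

/-! ### Freeness of power series over p-th powers, and dimensions of Frobenius powers. -/

section Frobenius

theorem frobeniusPower_eq_map {R : Type*} [CommRing R] (p : ℕ) [ExpChar R p] (I : Ideal R)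
    (e : ℕ) : frobeniusPower I (p ^ e) = I.map (iterateFrobenius R p e) := rfl

theorem frobeniusPower_zero {R : Type*} [CommRing R] (p : ℕ) [ExpChar R p] (I : Ideal R) :
    frobeniusPower I (p ^ 0) = I := by
  rw [frobeniusPower_eq_map, iterateFrobenius_zero, Ideal.map_id]

theorem map_frobenius_frobeniusPower {R : Type*} [CommRing R] (p : ℕ) [ExpChar R p] (I : Ideal R)
    (e : ℕ) : (frobeniusPower I (p ^ e)).map (frobenius R p) = frobeniusPower I (p ^ (e + 1)) := by
  rw [frobeniusPower_eq_map, frobeniusPower_eq_map, Ideal.map_map]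
  congr 1
  ext r
  simp only [RingHom.comp_apply, iterateFrobenius_def, frobenius_def, ← pow_mul, pow_succ]

theorem map_frobenius_powIdeal {R : Type*} [CommRing R] [IsLocalRing R] (p : ℕ) [ExpChar R p]
    (f : R) (e t : ℕ) :
    (powIdeal p f e t).map (frobenius R p) = powIdeal p f (e + 1) (p * t) := by
  rw [powIdeal, powIdeal, Ideal.map_sup, map_frobenius_frobeniusPower, Ideal.map_span,
    Set.image_singleton, frobenius_def, ← pow_mul, mul_comm]

variable {k : Type*} [Field k] (p : ℕ) [Fact p.Prime] [CharP k p]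

instance instExpCharMvPowerSeries {σ : Type*} : ExpChar (MvPowerSeries σ k) p :=
  expChar_of_injective_algebraMap (algebraMap k (MvPowerSeries σ k)).injective p

/-- The exponent vector of a function with values in `Fin p`. -/
def finExponent {σ : Type*} [Finite σ] (a : σ → Fin p) : σ →₀ ℕ :=
  Finsupp.equivFunOnFinite.symm fun i => (a i : ℕ)

theorem coeff_pow_smul {σ : Type*} (g : MvPowerSeries σ k) (c : σ →₀ ℕ) :
    (g ^ p).coeff (p • c) = g.coeff c ^ p := by
  rw [← MvPowerSeries.map_frobenius_expand p (Fact.out : p.Prime).ne_zero,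
    MvPowerSeries.coeff_map, MvPowerSeries.coeff_expand_smul, frobenius_def]

theorem coeff_pow_of_not_dvd {σ : Type*} (g : MvPowerSeries σ k) {m : σ →₀ ℕ} {i : σ}
    (h : ¬ p ∣ m i) : (g ^ p).coeff m = 0 := by
  rw [← MvPowerSeries.map_frobenius_expand p (Fact.out : p.Prime).ne_zero,
    MvPowerSeries.coeff_map, MvPowerSeries.coeff_expand_of_not_dvd _ _ _ h, map_zero]

/-- All exponents occurring in X^a g^p are congruent to a modulo p, so distinct residue vectors
never interact. -/
theorem coeff_monomial_mul_pow {σ : Type*} [Finite σ] (g : MvPowerSeries σ k) (a b : σ → Fin p)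
    (c : σ →₀ ℕ) [Decidable (a = b)] :
    (MvPowerSeries.monomial (finExponent p a) 1 * g ^ p).coeff (finExponent p b + p • c) =
      if a = b then g.coeff c ^ p else 0 := by
  classical
  split_ifs with h
  · rw [h, MvPowerSeries.coeff_add_monomial_mul, one_mul, coeff_pow_smul]
  · rw [MvPowerSeries.coeff_monomial_mul]
    split_ifs with hle
    · obtain ⟨i, hi⟩ := Function.ne_iff.mp h
      rw [coeff_pow_of_not_dvd p (i := i), mul_zero]
      rintro ⟨d, hd⟩
      have hlei := hle i
      simp only [finExponent, Finsupp.coe_tsub, Finsupp.coe_add, Finsupp.coe_smul, Pi.sub_apply,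
        Pi.add_apply, Pi.smul_apply, smul_eq_mul, Finsupp.equivFunOnFinite_symm_apply_apply]
        at hd hlei
      apply hi
      have h1 : (b i : ℕ) + p * c i = a i + p * d := by omega
      have h2 := congrArg (· % p) h1
      simp only [Nat.add_mul_mod_self_left, Nat.mod_eq_of_lt (a i).2, Nat.mod_eq_of_lt (b i).2]
        at h2
      exact Fin.ext h2.symm
    · rfl

/-- The map `(g_a) ↦ ∑ X^a g_a^p`, which exhibits the monomials `X^a` with `0 ≤ a_i < p`
as a basis of the ring of power series over its subring of `p`-th powers. -/
def frobeniusSum {σ : Type*} [Finite σ] [Fintype (σ → Fin p)]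
    (g : (σ → Fin p) → MvPowerSeries σ k) : MvPowerSeries σ k :=
  ∑ a, MvPowerSeries.monomial (finExponent p a) 1 * g a ^ p

variable {σ : Type*} [Finite σ] [Fintype (σ → Fin p)]

theorem coeff_frobeniusSum (g : (σ → Fin p) → MvPowerSeries σ k) (a : σ → Fin p) (c : σ →₀ ℕ) :
    (frobeniusSum p g).coeff (finExponent p a + p • c) = (g a).coeff c ^ p := by
  classical
  rw [frobeniusSum, map_sum, Finset.sum_eq_single a]
  · rw [coeff_monomial_mul_pow, if_pos rfl]
  · intro b _ hb
    rw [coeff_monomial_mul_pow, if_neg hb]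
  · simp

theorem frobeniusSum_injective :
    Function.Injective (frobeniusSum (k := k) (σ := σ) p) := by
  intro g h hgh
  funext a
  ext c
  apply frobenius_inj k p
  simp only [frobenius_def]
  rw [← coeff_frobeniusSum, ← coeff_frobeniusSum, hgh]

omit [Fintype (σ → Fin p)] in
theorem exists_finExponent_add (m : σ →₀ ℕ) :
    ∃ (a : σ → Fin p) (c : σ →₀ ℕ), m = finExponent p a + p • c := by
  have hp : 0 < p := (Fact.out : p.Prime).pos
  refine ⟨fun i => ⟨m i % p, Nat.mod_lt _ hp⟩,
    Finsupp.equivFunOnFinite.symm fun i => m i / p, ?_⟩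
  ext i
  simp [finExponent, Nat.mod_add_div]

/-- Perfectness enters here: sort the exponents by residue modulo p and take p-th roots of the
coefficients. -/
theorem frobeniusSum_surjective [PerfectField k] :
    Function.Surjective (frobeniusSum (k := k) (σ := σ) p) := by
  have : PerfectRing k p := PerfectField.toPerfectRing p
  intro r
  refine ⟨fun a c => (frobeniusEquiv k p).symm (r.coeff (finExponent p a + p • c)), ?_⟩
  ext m
  obtain ⟨a, c, rfl⟩ := exists_finExponent_add p m
  exact (coeff_frobeniusSum p _ a c).trans (frobeniusEquiv_symm_pow_p k p _)

theorem frobeniusSum_add (g h : (σ → Fin p) → MvPowerSeries σ k) :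
    frobeniusSum p (g + h) = frobeniusSum p g + frobeniusSum p h := by
  simp only [frobeniusSum, ← Finset.sum_add_distrib, ← mul_add, Pi.add_apply, add_pow_expChar]

/-- `frobeniusSum` as an additive homomorphism. -/
def frobeniusSumHom : ((σ → Fin p) → MvPowerSeries σ k) →+ MvPowerSeries σ k where
  toFun := frobeniusSum p
  map_zero' := by simp [frobeniusSum, (Fact.out : p.Prime).ne_zero]
  map_add' := frobeniusSum_add p

omit [Fact p.Prime] [CharP k p] in
theorem frobeniusSum_mul_pow (g : (σ → Fin p) → MvPowerSeries σ k) (h : MvPowerSeries σ k) :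
    frobeniusSum p g * h ^ p = frobeniusSum p (fun a => g a * h) := by
  simp only [frobeniusSum, Finset.sum_mul, mul_pow, mul_assoc]

/-- A p-th power of an element of I can be absorbed into the coefficients of any expansion, which
then lie in I; this handles both the generators and arbitrary multipliers. -/
theorem exists_frobeniusSum_of_mem [PerfectField k] {I : Ideal (MvPowerSeries σ k)}
    {r : MvPowerSeries σ k} (hr : r ∈ I.map (frobenius (MvPowerSeries σ k) p)) :
    ∃ g : (σ → Fin p) → MvPowerSeries σ k, (∀ a, g a ∈ I) ∧ frobeniusSum p g = r := by
  induction hr using Submodule.span_induction with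
  | mem x hx =>
    obtain ⟨h, hh, rfl⟩ := hx
    obtain ⟨g, hg⟩ := frobeniusSum_surjective (k := k) (σ := σ) p 1
    refine ⟨fun a => g a * h, fun a => I.mul_mem_left _ hh, ?_⟩
    rw [← frobeniusSum_mul_pow, hg, one_mul]; rfl
  | zero =>
    exact ⟨0, fun a => I.zero_mem, map_zero (frobeniusSumHom p)⟩
  | add x y _ _ hx hy =>
    obtain ⟨g, hg, rfl⟩ := hx
    obtain ⟨h, hh, rfl⟩ := hy
    exact ⟨g + h, fun a => I.add_mem (hg a) (hh a), frobeniusSum_add p g h⟩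
  | smul s x _ hx =>
    obtain ⟨g, hg, rfl⟩ := hx
    -- The multiplier s is not a p-th power, so s X^a is expanded afresh before absorbing `g a ^ p`.
    have key : ∀ a, ∃ u : (σ → Fin p) → MvPowerSeries σ k, (∀ b, u b ∈ I) ∧
        frobeniusSum p u = s * (MvPowerSeries.monomial (finExponent p a) 1 * g a ^ p) := by
      intro a
      obtain ⟨v, hv⟩ := frobeniusSum_surjective p
        (s * MvPowerSeries.monomial (finExponent p a) 1)
      refine ⟨fun b => v b * g a, fun b => I.mul_mem_left _ (hg a), ?_⟩
      rw [← frobeniusSum_mul_pow, hv, mul_assoc]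
    choose u hu hus using key
    refine ⟨∑ a, u a, fun b => ?_, ?_⟩
    · rw [Finset.sum_apply]
      exact I.sum_mem fun a _ => hu a b
    · have hsum : frobeniusSum p (∑ a, u a) = ∑ a, frobeniusSum p (u a) :=
        map_sum (frobeniusSumHom p) u Finset.univ
      rw [hsum, smul_eq_mul]
      simp only [hus]
      rw [← Finset.mul_sum, frobeniusSum]

/-- The Frobenius `R/I → R/I^[p]`. -/
def quotientFrobenius {R : Type*} [CommRing R] [ExpChar R p] (I : Ideal R) :
    R ⧸ I →+* R ⧸ I.map (frobenius R p) :=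
  Ideal.quotientMap _ (frobenius R p) Ideal.le_comap_map

/-- The map `(R/I)^(p^d) → R/I^[p]` induced by `frobeniusSum`, for a power series ring in `d`
variables. -/
def quotientFrobeniusSum (I : Ideal (MvPowerSeries σ k)) :
    ((σ → Fin p) → MvPowerSeries σ k ⧸ I) →+
      MvPowerSeries σ k ⧸ I.map (frobenius (MvPowerSeries σ k) p) where
  toFun v := ∑ a, Ideal.Quotient.mk (I.map (frobenius (MvPowerSeries σ k) p))
    (MvPowerSeries.monomial (finExponent p a) 1) * quotientFrobenius p I (v a)
  map_zero' := by simp only [Pi.zero_apply, map_zero, mul_zero, Finset.sum_const_zero]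
  map_add' v w := by simp only [Pi.add_apply, map_add, mul_add, Finset.sum_add_distrib]

theorem quotientFrobeniusSum_apply (I : Ideal (MvPowerSeries σ k))
    (v : (σ → Fin p) → MvPowerSeries σ k ⧸ I) :
    quotientFrobeniusSum p I v = ∑ a, Ideal.Quotient.mk (I.map (frobenius (MvPowerSeries σ k) p))
      (MvPowerSeries.monomial (finExponent p a) 1) * quotientFrobenius p I (v a) := rfl

theorem quotientFrobeniusSum_mk (I : Ideal (MvPowerSeries σ k))
    (g : (σ → Fin p) → MvPowerSeries σ k) :
    quotientFrobeniusSum p I (fun a => Ideal.Quotient.mk I (g a)) =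
      Ideal.Quotient.mk (I.map (frobenius (MvPowerSeries σ k) p)) (frobeniusSum p g) := by
  rw [quotientFrobeniusSum_apply, frobeniusSum, map_sum]
  refine Finset.sum_congr rfl fun a _ => ?_
  rw [map_mul, quotientFrobenius, Ideal.quotientMap_mk, frobenius_def]

theorem quotientFrobeniusSum_bijective [PerfectField k] (I : Ideal (MvPowerSeries σ k)) :
    Function.Bijective (quotientFrobeniusSum p I) := by
  constructor
  · rw [injective_iff_map_eq_zero]
    intro v hv
    choose g hg using fun a => Ideal.Quotient.mk_surjective (v a)
    obtain rfl : (fun a => Ideal.Quotient.mk I (g a)) = v := funext hg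
    rw [quotientFrobeniusSum_mk, Ideal.Quotient.eq_zero_iff_mem] at hv
    obtain ⟨h, hh, hhg⟩ := exists_frobeniusSum_of_mem p hv
    obtain rfl := frobeniusSum_injective p hhg
    funext a
    exact Ideal.Quotient.eq_zero_iff_mem.mpr (hh a)
  · intro r
    obtain ⟨r, rfl⟩ := Ideal.Quotient.mk_surjective r
    obtain ⟨g, rfl⟩ := frobeniusSum_surjective p r
    exact ⟨fun a => Ideal.Quotient.mk I (g a), quotientFrobeniusSum_mk p I g⟩

omit [Finite σ] [Fintype (σ → Fin p)] in
theorem quotientFrobenius_smul (I : Ideal (MvPowerSeries σ k)) (c : k)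
    (x : MvPowerSeries σ k ⧸ I) :
    quotientFrobenius p I (c • x) = c ^ p • quotientFrobenius p I x := by
  obtain ⟨x, rfl⟩ := Ideal.Quotient.mk_surjective x
  have h : ∀ (J : Ideal (MvPowerSeries σ k)) (d : k) (y : MvPowerSeries σ k),
      d • Ideal.Quotient.mk J y = Ideal.Quotient.mk J (d • y) := fun J d y => rfl
  rw [h, quotientFrobenius, Ideal.quotientMap_mk, Ideal.quotientMap_mk, h, frobenius_def,
    frobenius_def, smul_pow]

/-- The bijection `quotientFrobeniusSum` is only semilinear over the Frobenius of k; as that is an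
automorphism, dimensions still agree. Using the cardinal rank lets finiteness of R/I^[p] be deduced
rather than assumed. -/
theorem rank_quotient_map_frobenius [PerfectField k] (I : Ideal (MvPowerSeries σ k)) :
    Module.rank k (MvPowerSeries σ k ⧸ I.map (frobenius (MvPowerSeries σ k) p)) =
      Module.rank k ((σ → Fin p) → MvPowerSeries σ k ⧸ I) := by
  have : PerfectRing k p := PerfectField.toPerfectRing p
  symm
  refine rank_eq_of_equiv_equiv (frobeniusEquiv k p)
    (AddEquiv.ofBijective _ (quotientFrobeniusSum_bijective p I))
    (frobeniusEquiv k p).bijective fun c v => ?_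
  rw [AddEquiv.ofBijective_apply, AddEquiv.ofBijective_apply, quotientFrobeniusSum_apply,
    quotientFrobeniusSum_apply, Finset.smul_sum]
  refine Finset.sum_congr rfl fun a _ => ?_
  rw [Pi.smul_apply, quotientFrobenius_smul, frobeniusEquiv_def, mul_smul_comm]

theorem finite_quotient_map_frobenius [PerfectField k] (I : Ideal (MvPowerSeries σ k))
    [Module.Finite k (MvPowerSeries σ k ⧸ I)] :
    Module.Finite k (MvPowerSeries σ k ⧸ I.map (frobenius (MvPowerSeries σ k) p)) := by
  rw [← Module.rank_lt_aleph0_iff, rank_quotient_map_frobenius, Module.rank_lt_aleph0_iff]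
  infer_instance

theorem finrank_quotient_map_frobenius [PerfectField k] (I : Ideal (MvPowerSeries σ k))
    [Module.Finite k (MvPowerSeries σ k ⧸ I)] :
    Module.finrank k (MvPowerSeries σ k ⧸ I.map (frobenius (MvPowerSeries σ k) p)) =
      p ^ Nat.card σ * Module.finrank k (MvPowerSeries σ k ⧸ I) := by
  rw [Module.finrank, rank_quotient_map_frobenius]
  change Module.finrank k _ = _
  rw [Module.finrank_pi_fintype, Finset.sum_const, Finset.card_univ, smul_eq_mul,
    ← Nat.card_eq_fintype_card, Nat.card_fun]
  simp

end Frobenius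

/-! ### Length versus dimension over k, and monotonicity in t. -/

section Length

theorem length_quotient_eq_add {R : Type*} [CommRing R] {I J : Ideal R} (h : J ≤ I) :
    Module.length R (R ⧸ J) =
      Module.length R (I ⧸ Submodule.submoduleOf J I) + Module.length R (R ⧸ I) := by
  refine Module.length_eq_add_of_exact
    (Submodule.mapQ (J.submoduleOf I) J I.subtype le_rfl) (Submodule.factor h) ?_
    (Submodule.factor_surjective h) ?_
  · rw [injective_iff_map_eq_zero]
    intro x hx
    obtain ⟨x, rfl⟩ := Submodule.mkQ_surjective _ x
    exact (Submodule.Quotient.mk_eq_zero _).mpr ((Submodule.Quotient.mk_eq_zero J).mp hx)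
  · intro x
    obtain ⟨x, rfl⟩ := Submodule.mkQ_surjective _ x
    constructor
    · intro hx
      have hx' : x ∈ I := (Submodule.Quotient.mk_eq_zero I).mp hx
      exact ⟨Submodule.Quotient.mk ⟨x, hx'⟩, rfl⟩
    · rintro ⟨y, hy⟩
      obtain ⟨y, rfl⟩ := Submodule.mkQ_surjective _ y
      rw [← hy]
      exact (Submodule.Quotient.mk_eq_zero I).mpr y.2

theorem length_eq_one_of_isSimpleModule {k A M : Type*} [Field k] [CommRing A] [IsLocalRing A]
    [Algebra k A] [AddCommGroup M] [Module A M] [Module k M] [IsScalarTower k A M]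
    (hk : Function.Surjective (algebraMap k (IsLocalRing.ResidueField A)))
    [hM : IsSimpleModule A M] : Module.length k M = 1 := by
  obtain ⟨I, hI, ⟨e⟩⟩ := isSimpleModule_iff_quot_maximal.mp hM
  obtain rfl := IsLocalRing.eq_maximalIdeal hI
  have e' : M ≃ₗ[k] (A ⧸ IsLocalRing.maximalIdeal A) := e.restrictScalars k
  let g : k ≃ₗ[k] IsLocalRing.ResidueField A :=
    LinearEquiv.ofBijective (Algebra.linearMap k (IsLocalRing.ResidueField A))
      ⟨(algebraMap k (IsLocalRing.ResidueField A)).injective, hk⟩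
  have h1 : Module.length k (A ⧸ IsLocalRing.maximalIdeal A) = Module.length k k :=
    g.symm.length_eq
  rw [e'.length_eq, h1, Module.length_eq_one]

/-- Each simple factor is the residue field, which is one-dimensional over k. The k-structure is
quantified after the colon so that the induction hypothesis applies to submodules. -/
theorem _root_.IsFiniteLength.length_eq_of_residueField {k A M : Type*} [Field k] [CommRing A]
    [IsLocalRing A] [Algebra k A] [AddCommGroup M] [Module A M]
    (hk : Function.Surjective (algebraMap k (IsLocalRing.ResidueField A)))
    (hM : IsFiniteLength A M) :
    ∀ [Module k M] [IsScalarTower k A M], Module.length A M = Module.length k M := by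
  induction hM with
  | of_subsingleton =>
    intros
    rw [Module.length_eq_zero, Module.length_eq_zero]
  | @of_simple_quotient M _ _ N _ _ ih =>
    intros
    rw [Module.length_eq_add_of_exact N.subtype N.mkQ N.subtype_injective N.mkQ_surjective
        (LinearMap.exact_subtype_mkQ N),
      Module.length_eq_add_of_exact (N.subtype.restrictScalars k) (N.mkQ.restrictScalars k)
        N.subtype_injective N.mkQ_surjective (LinearMap.exact_subtype_mkQ N),
      Module.length_eq_one A (M ⧸ N), ih, length_eq_one_of_isSimpleModule (M := M ⧸ N) hk]

theorem isFiniteLength_of_finite {k A M : Type*} [Field k] [CommRing A]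
    [Algebra k A] [AddCommGroup M] [Module A M] [Module k M] [IsScalarTower k A M]
    [Module.Finite k M] : IsFiniteLength A M :=
  isFiniteLength_iff_isNoetherian_isArtinian.mpr
    ⟨isNoetherian_of_tower k inferInstance, isArtinian_of_tower k inferInstance⟩

theorem length_eq_finrank_of_residueField {k A M : Type*} [Field k] [CommRing A]
    [IsLocalRing A] [Algebra k A] [AddCommGroup M] [Module A M] [Module k M]
    [IsScalarTower k A M] [Module.Finite k M]
    (hk : Function.Surjective (algebraMap k (IsLocalRing.ResidueField A))) :
    Module.length A M = Module.finrank k M := by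
  rw [(isFiniteLength_of_finite (k := k)).length_eq_of_residueField hk, Module.length_eq_finrank]

theorem powIdeal_succ_le {R : Type*} [CommRing R] [IsLocalRing R] (p : ℕ) (f : R) (e t : ℕ) :
    powIdeal p f e (t + 1) ≤ powIdeal p f e t :=
  sup_le_sup_right (Ideal.span_singleton_le_span_singleton.mpr (pow_dvd_pow f t.le_succ)) _

theorem mul_mem_powIdeal_succ {R : Type*} [CommRing R] [IsLocalRing R] {p : ℕ} {f : R} {e t : ℕ}
    {x : R} (hx : x ∈ powIdeal p f e t) : f * x ∈ powIdeal p f e (t + 1) := by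
  obtain ⟨y, hy, z, hz, rfl⟩ := Submodule.mem_sup.mp hx
  obtain ⟨c, rfl⟩ := Ideal.mem_span_singleton.mp hy
  rw [mul_add, ← mul_assoc, ← pow_succ']
  exact Ideal.add_mem _
    (Ideal.mem_sup_left (Ideal.mul_mem_right _ _ (Ideal.mem_span_singleton_self _)))
    (Ideal.mem_sup_right (Ideal.mul_mem_left _ _ hz))

/-- Multiplication by f is onto: modulo 𝔪^[p^e] every element of the target ideal is f times a
multiple of f^t. -/
theorem length_M_succ_le {R : Type*} [CommRing R] [IsLocalRing R] (p : ℕ) (f : R) (e t : ℕ) :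
    Module.length R (M p f e (t + 1)) ≤ Module.length R (M p f e t) := by
  let g : powIdeal p f e t →ₗ[R] powIdeal p f e (t + 1) :=
    (LinearMap.lsmul R R f).restrict fun x hx => mul_mem_powIdeal_succ hx
  refine Module.length_le_of_surjective (Submodule.mapQ _ _ g fun x hx => ?_) ?_
  · exact mul_mem_powIdeal_succ (t := t + 1) hx
  · intro x
    obtain ⟨⟨x, hx⟩, rfl⟩ := Submodule.mkQ_surjective _ x
    obtain ⟨y, hy, z, hz, rfl⟩ := Submodule.mem_sup.mp hx
    obtain ⟨c, rfl⟩ := Ideal.mem_span_singleton.mp hy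
    refine ⟨Submodule.Quotient.mk ⟨f ^ t * c,
      Ideal.mem_sup_left (Ideal.mul_mem_right _ _ (Ideal.mem_span_singleton_self _))⟩, ?_⟩
    refine (Submodule.Quotient.eq _).mpr ?_
    change f * (f ^ t * c) - (f ^ (t + 1) * c + z) ∈ powIdeal p f e (t + 1 + 1)
    have : f * (f ^ t * c) - (f ^ (t + 1) * c + z) = -z := by ring
    rw [this]
    exact Ideal.mem_sup_right (neg_mem hz)

end Length

/-! ### The growth bound for R/((f) + 𝔪^[p^e]). -/

section PowerSeries

variable {k : Type*} [Field k] {σ : Type*}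

theorem mem_maximalIdeal_iff {f : MvPowerSeries σ k} :
    f ∈ IsLocalRing.maximalIdeal (MvPowerSeries σ k) ↔ f.constantCoeff = 0 := by
  rw [IsLocalRing.mem_maximalIdeal, mem_nonunits_iff, MvPowerSeries.isUnit_iff_constantCoeff,
    isUnit_iff_ne_zero, not_not]

theorem algebraMap_residueField_surjective :
    Function.Surjective (algebraMap k (IsLocalRing.ResidueField (MvPowerSeries σ k))) := by
  intro x
  obtain ⟨x, rfl⟩ := IsLocalRing.residue_surjective x
  refine ⟨x.constantCoeff, ?_⟩
  refine (Ideal.Quotient.eq (I := IsLocalRing.maximalIdeal (MvPowerSeries σ k))).mpr ?_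
  rw [mem_maximalIdeal_iff, map_sub, sub_eq_zero]
  exact MvPowerSeries.constantCoeff_C _

theorem finite_residueField :
    Module.Finite k (MvPowerSeries σ k ⧸ IsLocalRing.maximalIdeal (MvPowerSeries σ k)) :=
  Module.Finite.of_surjective
    (Algebra.linearMap k (IsLocalRing.ResidueField (MvPowerSeries σ k)))
    algebraMap_residueField_surjective

theorem finrank_residueField :
    Module.finrank k (MvPowerSeries σ k ⧸ IsLocalRing.maximalIdeal (MvPowerSeries σ k)) = 1 := by
  have h := (LinearEquiv.ofBijective
    (Algebra.linearMap k (IsLocalRing.ResidueField (MvPowerSeries σ k)))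
    ⟨(algebraMap k _).injective, algebraMap_residueField_surjective⟩).finrank_eq
  rw [Module.finrank_self] at h
  exact h.symm

variable (p : ℕ) [Fact p.Prime] [CharP k p]

/-- The exponents of g^(p^e) are divisible by p^e, so inside the box only the constant term could
survive, and it vanishes for g in 𝔪. The box is closed under passing to smaller exponents, hence
multiples are harmless. -/
theorem coeff_eq_zero_of_mem_frobeniusPower {e : ℕ} {r : MvPowerSeries σ k}
    (hr : r ∈ frobeniusPower (IsLocalRing.maximalIdeal (MvPowerSeries σ k)) (p ^ e)) :
    ∀ b : σ →₀ ℕ, (∀ i, b i < p ^ e) → r.coeff b = 0 := by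
  classical
  have hp : p ≠ 0 := (Fact.out : p.Prime).ne_zero
  induction hr using Submodule.span_induction with
  | mem x hx =>
    obtain ⟨g, hg, rfl⟩ := hx
    intro b hb
    change (g ^ p ^ e).coeff b = 0
    rw [← MvPowerSeries.map_iterateFrobenius_expand p hp, MvPowerSeries.coeff_map]
    by_cases hdvd : ∀ i, p ^ e ∣ b i
    · obtain rfl : b = 0 := by
        ext i
        exact Nat.eq_zero_of_dvd_of_lt (hdvd i) (hb i)
      rw [MvPowerSeries.coeff_zero_eq_constantCoeff, MvPowerSeries.constantCoeff_expand,
        mem_maximalIdeal_iff.mp hg, map_zero]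
    · obtain ⟨i, hi⟩ := not_forall.mp hdvd
      rw [MvPowerSeries.coeff_expand_of_not_dvd _ _ _ hi, map_zero]
  | zero => intro b _; exact map_zero _
  | add x y _ _ hx hy => intro b hb; rw [map_add, hx b hb, hy b hb, add_zero]
  | smul s x _ hx =>
    intro b hb
    rw [smul_eq_mul, MvPowerSeries.coeff_mul]
    refine Finset.sum_eq_zero fun u hu => ?_
    rw [hx u.2 fun i => lt_of_le_of_lt ?_ (hb i), mul_zero]
    rw [← Finset.HasAntidiagonal.mem_antidiagonal.mp hu, Finsupp.add_apply]
    exact Nat.le_add_left _ _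

theorem finite_and_finrank_quotient_frobeniusPower [Finite σ] [PerfectField k] (e : ℕ) :
    Module.Finite k (MvPowerSeries σ k ⧸
        frobeniusPower (IsLocalRing.maximalIdeal (MvPowerSeries σ k)) (p ^ e)) ∧
      Module.finrank k (MvPowerSeries σ k ⧸
        frobeniusPower (IsLocalRing.maximalIdeal (MvPowerSeries σ k)) (p ^ e)) =
          (p ^ e) ^ Nat.card σ := by
  classical
  have := Fintype.ofFinite σ
  induction e with
  | zero =>
    rw [frobeniusPower_zero, pow_zero, one_pow]
    exact ⟨finite_residueField, finrank_residueField⟩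
  | succ e ih =>
    have := ih.1
    rw [← map_frobenius_frobeniusPower]
    refine ⟨finite_quotient_map_frobenius p _, ?_⟩
    rw [finrank_quotient_map_frobenius, ih.2, pow_succ', mul_pow]

/-- This is ∏(1 - a_i/q) ≥ 1 - ∑ a_i/q with denominators cleared; the spare factor q avoids the
exponent `s.card - 1`. Truncated subtraction does no harm, since q ≤ (q - a_i) + a_i always. -/
theorem pow_succ_card_le {ι : Type*} (s : Finset ι) (a : ι → ℕ) (q : ℕ) :
    q ^ (s.card + 1) ≤ q * ∏ i ∈ s, (q - a i) + (∑ i ∈ s, a i) * q ^ s.card := by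
  classical
  induction s using Finset.induction_on with
  | empty => simp
  | insert j s hj ih =>
    rw [Finset.card_insert_of_notMem hj, Finset.prod_insert hj, Finset.sum_insert hj]
    have h1 : ∏ i ∈ s, (q - a i) ≤ q ^ s.card :=
      Finset.prod_le_pow_card _ _ _ fun i _ => Nat.sub_le _ _
    have h2 : q ≤ (q - a j) + a j := by omega
    calc q ^ (s.card + 1 + 1) = q * q ^ (s.card + 1) := by ring
      _ ≤ q * (q * ∏ i ∈ s, (q - a i) + (∑ i ∈ s, a i) * q ^ s.card) := by gcongr
      _ = q * (q * ∏ i ∈ s, (q - a i)) + (∑ i ∈ s, a i) * q ^ (s.card + 1) := by ring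
      _ ≤ q * (((q - a j) + a j) * ∏ i ∈ s, (q - a i)) + (∑ i ∈ s, a i) * q ^ (s.card + 1) := by
        gcongr
      _ = q * ((q - a j) * ∏ i ∈ s, (q - a i)) + a j * q * (∏ i ∈ s, (q - a i)) +
          (∑ i ∈ s, a i) * q ^ (s.card + 1) := by ring
      _ ≤ q * ((q - a j) * ∏ i ∈ s, (q - a i)) + a j * q * q ^ s.card +
          (∑ i ∈ s, a i) * q ^ (s.card + 1) := by gcongr
      _ = _ := by ring

/-- The polynomial with coefficient `v b` at the exponent `b`, for `b` in a box. -/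
def boxPolynomial [Finite σ] {m : σ → ℕ} [Fintype ((i : σ) → Fin (m i))] :
    (((i : σ) → Fin (m i)) → k) →ₗ[k] MvPowerSeries σ k :=
  Fintype.linearCombination k fun b : (i : σ) → Fin (m i) =>
    (MvPowerSeries.monomial (Finsupp.equivFunOnFinite.symm fun i => (b i : ℕ)) (1 : k))

theorem coeff_boxPolynomial [Finite σ] {m : σ → ℕ} [Fintype ((i : σ) → Fin (m i))]
    (v : ((i : σ) → Fin (m i)) → k) (b : (i : σ) → Fin (m i)) :
    (boxPolynomial v).coeff (Finsupp.equivFunOnFinite.symm fun i => (b i : ℕ)) = v b := by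
  classical
  rw [boxPolynomial, Fintype.linearCombination_apply, map_sum, Finset.sum_eq_single b]
  · simp
  · intro c _ hc
    rw [MvPowerSeries.coeff_smul, MvPowerSeries.coeff_monomial, if_neg, mul_zero]
    intro h
    apply hc
    funext i
    exact (Fin.ext (congrFun (Finsupp.equivFunOnFinite.symm.injective h) i)).symm
  · simp

theorem lt_of_coeff_boxPolynomial_ne_zero [Finite σ] {m : σ → ℕ}
    [Fintype ((i : σ) → Fin (m i))] {v : ((i : σ) → Fin (m i)) → k} {c : σ →₀ ℕ}
    (h : (boxPolynomial v).coeff c ≠ 0) (i : σ) : c i < m i := by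
  classical
  rw [boxPolynomial, Fintype.linearCombination_apply, map_sum] at h
  obtain ⟨b, _, hb⟩ := Finset.exists_ne_zero_of_sum_ne_zero h
  rw [MvPowerSeries.coeff_smul, MvPowerSeries.coeff_monomial] at hb
  have hcb : c = Finsupp.equivFunOnFinite.symm fun i => (b i : ℕ) := by
    by_contra hne
    rw [if_neg hne, mul_zero] at hb
    exact hb rfl
  rw [hcb]
  exact (b i).2

/-- With q = p^e, let h ≠ 0 have exponents b with b_i < q - a_i. The lexicographic leading exponent
of hf is a plus that of h, so it stays below q in every coordinate and hf ∉ 𝔪^[q]. Thus h ↦ hf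
embeds a space of dimension ∏(q - a_i) into J/𝔪^[q], while dim R/𝔪^[q] = q^d for d variables. -/
theorem prod_le_finrank_ker [Fintype σ] [LinearOrder σ] [WellFoundedGT σ] [PerfectField k]
    {f : MvPowerSeries σ k} {a : σ →₀ ℕ} (ha : f.lexOrder = toLex a) (e : ℕ)
    (J : Ideal (MvPowerSeries σ k)) (hfJ : f ∈ J)
    (hJ : frobeniusPower (IsLocalRing.maximalIdeal (MvPowerSeries σ k)) (p ^ e) ≤ J) :
    Module.finrank k (MvPowerSeries σ k ⧸ J) + ∏ i, (p ^ e - a i) ≤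
      (p ^ e) ^ Fintype.card σ := by
  classical
  obtain ⟨hfin, hrank⟩ := finite_and_finrank_quotient_frobeniusPower (k := k) (σ := σ) p e
  set I := frobeniusPower (IsLocalRing.maximalIdeal (MvPowerSeries σ k)) (p ^ e) with hI
  let π : (MvPowerSeries σ k ⧸ I) →ₗ[k] (MvPowerSeries σ k ⧸ J) :=
    (Ideal.Quotient.factorₐ k hJ).toLinearMap
  have hπ : Function.Surjective π := Ideal.Quotient.factor_surjective hJ
  let L : (((i : σ) → Fin (p ^ e - a i)) → k) →ₗ[k] (MvPowerSeries σ k ⧸ I) :=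
    (Ideal.Quotient.mkₐ k I).toLinearMap ∘ₗ (LinearMap.mulRight k f) ∘ₗ boxPolynomial
  have hL : ∀ v, L v = Ideal.Quotient.mk I (boxPolynomial v * f) := fun v => rfl
  have hLπ : ∀ v, L v ∈ LinearMap.ker π := by
    intro v
    rw [LinearMap.mem_ker, hL]
    exact Ideal.Quotient.eq_zero_iff_mem.mpr (J.mul_mem_left _ hfJ)
  have hLinj : Function.Injective (L.codRestrict (LinearMap.ker π) hLπ) := by
    rw [injective_iff_map_eq_zero]
    intro v hv
    replace hv : L v = 0 := congrArg Subtype.val hv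
    rw [hL, Ideal.Quotient.eq_zero_iff_mem] at hv
    have hzero : boxPolynomial v = 0 := by
      by_contra hne
      obtain ⟨b, hb⟩ := MvPowerSeries.exists_finsupp_eq_lexOrder_of_ne_zero hne
      have hcb := MvPowerSeries.coeff_ne_zero_of_lexOrder hb.symm
      refine mul_ne_zero hcb (MvPowerSeries.coeff_ne_zero_of_lexOrder ha.symm) ?_
      rw [← MvPowerSeries.coeff_mul_of_add_lexOrder hb ha]
      refine coeff_eq_zero_of_mem_frobeniusPower p hv _ fun i => ?_
      have := lt_of_coeff_boxPolynomial_ne_zero hcb i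
      rw [Finsupp.add_apply]
      omega
    funext b
    rw [← coeff_boxPolynomial v b, hzero, map_zero, Pi.zero_apply]
  have h1 := LinearMap.finrank_le_finrank_of_injective hLinj
  have h2 := LinearMap.finrank_range_add_finrank_ker π
  rw [LinearMap.range_eq_top.mpr hπ, finrank_top, hrank, Nat.card_eq_fintype_card] at h2
  rw [Module.finrank_fintype_fun_eq_card, Fintype.card_pi] at h1
  simp only [Fintype.card_fin] at h1
  omega

theorem exists_finrank_le [PerfectField k] {n : ℕ} {f : MvPowerSeries (Fin (n + 1)) k}
    (hf : f ≠ 0) : ∃ K : ℕ, ∀ e : ℕ,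
      Module.finrank k (MvPowerSeries (Fin (n + 1)) k ⧸ powIdeal p f e 1) ≤ K * p ^ (e * n) := by
  obtain ⟨a, ha⟩ := MvPowerSeries.exists_finsupp_eq_lexOrder_of_ne_zero hf
  -- The constant is the total degree of the lexicographic leading monomial of f.
  refine ⟨∑ i, a i, fun e => ?_⟩
  have h1 := prod_le_finrank_ker p ha e (powIdeal p f e 1)
    (Ideal.mem_sup_left (by rw [pow_one]; exact Ideal.mem_span_singleton_self f)) le_sup_right
  have h2 := pow_succ_card_le Finset.univ a (p ^ e)
  rw [Finset.card_univ, Fintype.card_fin] at h2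
  rw [Fintype.card_fin] at h1
  have hq : 0 < p ^ e := pow_pos (Fact.out : p.Prime).pos e
  rw [pow_mul]
  refine Nat.le_of_mul_le_mul_left ?_ hq
  have h3 : p ^ e * Module.finrank k (MvPowerSeries (Fin (n + 1)) k ⧸ powIdeal p f e 1) +
      p ^ e * ∏ i, (p ^ e - a i) ≤ (p ^ e) ^ (n + 1 + 1) := by
    rw [← mul_add, pow_succ' _ (n + 1)]
    exact Nat.mul_le_mul_left _ h1
  have h4 : p ^ e * ((∑ i, a i) * (p ^ e) ^ n) = (∑ i, a i) * (p ^ e) ^ (n + 1) := by ring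
  omega

end PowerSeries

/-! ### The dimension of R/(f). -/

section KrullDimension

/-- For the upper bound, X lies in the Jacobson radical, so killing it lowers the dimension by at
most one, and S maps onto the quotient. -/
theorem ringKrullDim_powerSeries (S : Type*) [CommRing S] [IsNoetherianRing S] [IsLocalRing S] :
    ringKrullDim (PowerSeries S) = ringKrullDim S + 1 := by
  refine le_antisymm ?_ ringKrullDim_succ_le_ringKrullDim_powerseries
  have hX : (({PowerSeries.X} : Finset (PowerSeries S)) : Set (PowerSeries S)) ⊆
      Ring.jacobson (PowerSeries S) := by
    rw [Finset.coe_singleton, Set.singleton_subset_iff, IsLocalRing.ringJacobson_eq_maximalIdeal]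
    rw [SetLike.mem_coe, IsLocalRing.mem_maximalIdeal]
    intro h
    simpa using PowerSeries.isUnit_constantCoeff _ h
  refine (ringKrullDim_le_ringKrullDim_quotient_add_card _ hX).trans ?_
  rw [Finset.coe_singleton, Finset.card_singleton, Nat.cast_one]
  gcongr
  refine ringKrullDim_le_of_surjective
    ((Ideal.Quotient.mk (Ideal.span {PowerSeries.X})).comp (PowerSeries.C (R := S))) ?_
  intro x
  obtain ⟨x, rfl⟩ := Ideal.Quotient.mk_surjective x
  refine ⟨x.constantCoeff, ?_⟩
  rw [RingHom.comp_apply, Ideal.Quotient.eq, Ideal.mem_span_singleton, PowerSeries.X_dvd_iff,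
    map_sub, PowerSeries.constantCoeff_C, sub_self]

theorem ringKrullDim_mvPowerSeries (k : Type*) [Field k] (n : ℕ) :
    ringKrullDim (MvPowerSeries (Fin n) k) = n := by
  induction n with
  | zero =>
    rw [ringKrullDim_eq_of_ringEquiv (MvPowerSeries.isEmptyEquiv (Fin 0) k).toRingEquiv,
      ringKrullDim_eq_zero_of_field, Nat.cast_zero]
  | succ n ih =>
    rw [ringKrullDim_eq_of_ringEquiv (MvPowerSeries.finSuccEquiv k n).toRingEquiv,
      ringKrullDim_powerSeries, ih, Nat.cast_succ]

theorem krullDimNat_hypersurface {k : Type*} [Field k] {n : ℕ}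
    {f : MvPowerSeries (Fin (n + 1)) k} (hf0 : f ≠ 0)
    (hf : f ∈ IsLocalRing.maximalIdeal (MvPowerSeries (Fin (n + 1)) k)) :
    krullDimNat (MvPowerSeries (Fin (n + 1)) k ⧸ Ideal.span {f}) = n := by
  have h := ringKrullDim_quotient_span_singleton_succ_eq_ringKrullDim_of_mem_nonZeroDivisors
    (mem_nonZeroDivisors_of_ne_zero hf0) hf
  rw [ringKrullDim_mvPowerSeries, Nat.cast_succ] at h
  have h' : ringKrullDim (MvPowerSeries (Fin (n + 1)) k ⧸ Ideal.span {f}) = n :=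
    ENat.WithBot.add_one_cancel.mp h
  rw [krullDimNat, h']
  rfl

end KrullDimension

/-! ### Limits and endpoint continuity for self-averaging monotone arrays. -/

section SelfSimilar

/-- The step function attached to a double sequence `c e t`, `t < p ^ e`. -/
def stepFun (p : ℕ) (c : ℕ → ℕ → ℝ) (e : ℕ) (x : ℝ) : ℝ :=
  if x < 1 then c e ⌊x * (p : ℝ) ^ e⌋₊ else c e (p ^ e - 1)

/-- The pointwise upper limit of the functions `stepFun`. -/
def limStep (p : ℕ) (c : ℕ → ℕ → ℝ) (x : ℝ) : ℝ :=
  limsup (fun e => stepFun p c e x) atTop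

/-- A bounded nonnegative double sequence, nonincreasing in `t`, whose entry `c e t` is the mean of
the `p` entries `c (e + 1) (p * t + s)`: the slopes of a concave function on `[0, 1]` over the
`p`-adic subintervals. -/
structure IsSlopeSequence (p : ℕ) (c : ℕ → ℕ → ℝ) (K : ℝ) : Prop where
  two_le : 2 ≤ p
  nonneg : ∀ e t, 0 ≤ c e t
  antitone : ∀ e, Antitone (c e)
  sum_eq : ∀ e t, ∑ s ∈ Finset.range p, c (e + 1) (p * t + s) = p * c e t
  le_bound : ∀ e, c e 0 ≤ K

namespace IsSlopeSequence

variable {p : ℕ} {c : ℕ → ℕ → ℝ} {K : ℝ} (h : IsSlopeSequence p c K)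

include h

theorem p_pos : (0 : ℝ) < p := by
  have := h.two_le
  exact_mod_cast (by omega : 0 < p)

/-- The first of p nonincreasing numbers is at least their mean; dually the last, in `succ_le`, is
at most the mean. -/
theorem le_succ (e t : ℕ) : c e t ≤ c (e + 1) (p * t) := by
  have h1 : (p : ℝ) * c e t ≤ p * c (e + 1) (p * t) := by
    rw [← h.sum_eq e t]
    refine (Finset.sum_le_card_nsmul _ _ _ fun s _ => h.antitone (e + 1) (Nat.le_add_right _ s)).trans
      (le_of_eq ?_)
    rw [Finset.card_range, nsmul_eq_mul]
  exact le_of_mul_le_mul_left h1 h.p_pos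

theorem succ_le (e t : ℕ) : c (e + 1) (p * (t + 1) - 1) ≤ c e t := by
  have h1 : (p : ℝ) * c (e + 1) (p * (t + 1) - 1) ≤ p * c e t := by
    rw [← h.sum_eq e t]
    refine le_trans (le_of_eq ?_) (Finset.card_nsmul_le_sum _ _ (c (e + 1) (p * (t + 1) - 1))
      fun s hs => h.antitone (e + 1) ?_)
    · rw [Finset.card_range, nsmul_eq_mul]
    · have := Finset.mem_range.mp hs
      rw [mul_add, mul_one]
      omega
  exact le_of_mul_le_mul_left h1 h.p_pos

theorem le_add (e t j : ℕ) : c e t ≤ c (e + j) (p ^ j * t) := by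
  induction j with
  | zero => simp
  | succ j ih =>
    refine ih.trans ((h.le_succ _ _).trans (le_of_eq ?_))
    rw [add_assoc, pow_succ', mul_assoc]

theorem add_le (e t j : ℕ) : c (e + j) (p ^ j * (t + 1) - 1) ≤ c e t := by
  induction j with
  | zero => simp
  | succ j ih =>
    refine le_trans (le_of_eq ?_) ((h.succ_le (e + j) (p ^ j * (t + 1) - 1)).trans ih)
    have hpos : 0 < p ^ j * (t + 1) :=
      Nat.mul_pos (pow_pos (by have := h.two_le; omega) j) t.succ_pos
    rw [Nat.sub_add_cancel hpos, pow_succ', mul_assoc, add_assoc]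

theorem one_le_pow (e : ℕ) : 1 ≤ p ^ e := Nat.one_le_pow _ _ (by have := h.two_le; omega)

theorem le_K (e t : ℕ) : c e t ≤ K := (h.antitone e t.zero_le).trans (h.le_bound e)

theorem exists_tendsto_first : ∃ L, Tendsto (fun e => c e 0) atTop (𝓝 L) := by
  refine ⟨_, tendsto_atTop_ciSup (monotone_nat_of_le_succ fun e => ?_) ⟨K, ?_⟩⟩
  · exact h.le_succ e 0
  · rintro _ ⟨e, rfl⟩
    exact h.le_bound e

theorem exists_tendsto_last : ∃ L, Tendsto (fun e => c e (p ^ e - 1)) atTop (𝓝 L) := by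
  refine ⟨_, tendsto_atTop_ciInf (antitone_nat_of_succ_le fun e => ?_) ⟨0, ?_⟩⟩
  · refine le_trans (le_of_eq ?_) (h.succ_le e _)
    rw [Nat.sub_add_cancel (h.one_le_pow e), pow_succ']
  · rintro _ ⟨e, rfl⟩
    exact h.nonneg _ _

theorem sub_one_pos : (0 : ℝ) < p - 1 := by
  have h2 : ((2 : ℕ) : ℝ) ≤ p := Nat.cast_le.mpr h.two_le
  push_cast at h2
  linarith

/-- Averaging and monotonicity give p c(e,0) ≤ c(e+1,0) + (p-1) c(e+1,1). Hence c(e+1,1) lies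
between (p c(e,0) - c(e+1,0))/(p-1) and c(e+1,0), which have the same limit. -/
theorem tendsto_second {L : ℝ} (hL : Tendsto (fun e => c e 0) atTop (𝓝 L)) :
    Tendsto (fun e => c e 1) atTop (𝓝 L) := by
  have hp := h.sub_one_pos
  rw [← tendsto_add_atTop_iff_nat 1]
  have hL1 := (tendsto_add_atTop_iff_nat 1).mpr hL
  have hlow : Tendsto (fun e => (p * c e 0 - c (e + 1) 0) / (p - 1)) atTop
      (𝓝 ((p * L - L) / (p - 1))) := ((hL.const_mul _).sub hL1).div_const _
  have hval : (p * L - L) / ((p : ℝ) - 1) = L := by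
    field_simp
  rw [hval] at hlow
  refine tendsto_of_tendsto_of_tendsto_of_le_of_le hlow hL1 (fun e => ?_)
    fun e => h.antitone _ zero_le_one
  obtain ⟨q, rfl⟩ : ∃ q, p = q + 1 := ⟨p - 1, by have := h.two_le; omega⟩
  have h1 := h.sum_eq e 0
  rw [Finset.sum_range_succ'] at h1
  have h2 : ∑ s ∈ Finset.range q, c (e + 1) ((q + 1) * 0 + (s + 1)) ≤ q * c (e + 1) 1 := by
    refine (Finset.sum_le_card_nsmul _ _ (c (e + 1) 1) fun s _ => h.antitone (e + 1) ?_).trans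
      (le_of_eq ?_)
    · omega
    · rw [Finset.card_range, nsmul_eq_mul]
  rw [div_le_iff₀ hp]
  simp only [mul_zero, zero_add] at h1 h2
  push_cast at h1 ⊢
  linarith

/-- The mirror image of `tendsto_second`, applied to the last block of p entries. -/
theorem tendsto_penultimate {L : ℝ} (hL : Tendsto (fun e => c e (p ^ e - 1)) atTop (𝓝 L)) :
    Tendsto (fun e => c e (p ^ e - 2)) atTop (𝓝 L) := by
  have hp := h.sub_one_pos
  rw [← tendsto_add_atTop_iff_nat 1]
  have hL1 := (tendsto_add_atTop_iff_nat 1).mpr hL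
  have hupp : Tendsto (fun e => (p * c e (p ^ e - 1) - c (e + 1) (p ^ (e + 1) - 1)) / (p - 1)) atTop
      (𝓝 ((p * L - L) / (p - 1))) := ((hL.const_mul _).sub hL1).div_const _
  have hval : (p * L - L) / ((p : ℝ) - 1) = L := by
    field_simp
  rw [hval] at hupp
  refine tendsto_of_tendsto_of_tendsto_of_le_of_le hL1 hupp (fun e => h.antitone _ (by omega))
    fun e => ?_
  have h0 := h.one_le_pow e
  have htwo := h.two_le
  obtain ⟨q, rfl⟩ : ∃ q, p = q + 1 := ⟨p - 1, by omega⟩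
  obtain ⟨m, hm⟩ : ∃ m, (q + 1) ^ e = m + 1 := ⟨(q + 1) ^ e - 1, by omega⟩
  have hlast : (q + 1) ^ (e + 1) - 1 = (q + 1) * m + q := by
    rw [pow_succ', hm, mul_add, mul_one]
    omega
  have hpen : (q + 1) ^ (e + 1) - 2 = (q + 1) * m + q - 1 := by
    omega
  have hm' : (q + 1) ^ e - 1 = m := by omega
  have h1 := h.sum_eq e m
  rw [Finset.sum_range_succ] at h1
  have h2 : q * c (e + 1) ((q + 1) * m + q - 1) ≤
      ∑ s ∈ Finset.range q, c (e + 1) ((q + 1) * m + s) := by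
    refine le_trans (le_of_eq ?_) (Finset.card_nsmul_le_sum _ _
      (c (e + 1) ((q + 1) * m + q - 1)) fun s hs => h.antitone (e + 1) ?_)
    · rw [Finset.card_range, nsmul_eq_mul]
    · have := Finset.mem_range.mp hs
      omega
  dsimp only
  rw [hlast, hpen, hm', le_div_iff₀ hp]
  push_cast at h1 ⊢
  linarith

theorem floor_le (e : ℕ) {x : ℝ} (hx : x < 1) : ⌊x * (p : ℝ) ^ e⌋₊ ≤ p ^ e - 1 := by
  refine Nat.le_sub_one_of_lt ((Nat.floor_lt' (by have := h.one_le_pow e; omega)).mpr ?_)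
  rw [Nat.cast_pow]
  exact mul_lt_of_lt_one_left (pow_pos h.p_pos e) hx

theorem antitone_stepFun (e : ℕ) : Antitone (stepFun p c e) := by
  intro x y hxy
  rw [stepFun, stepFun]
  have hp := h.p_pos
  split_ifs with hy hx hx
  · exact h.antitone e (Nat.floor_mono (by gcongr))
  · exact absurd (hxy.trans_lt hy) hx
  · exact h.antitone e (h.floor_le e hx)
  · exact le_rfl

theorem stepFun_nonneg (e : ℕ) (x : ℝ) : 0 ≤ stepFun p c e x := by
  rw [stepFun]
  split_ifs <;> exact h.nonneg _ _

theorem stepFun_le (e : ℕ) (x : ℝ) : stepFun p c e x ≤ K := by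
  rw [stepFun]
  split_ifs <;> exact h.le_K _ _

theorem isBoundedUnder_le (x : ℝ) :
    IsBoundedUnder (· ≤ ·) atTop (fun e => stepFun p c e x) :=
  isBoundedUnder_of ⟨K, fun e => h.stepFun_le e x⟩

theorem isBoundedUnder_ge (x : ℝ) :
    IsBoundedUnder (· ≥ ·) atTop (fun e => stepFun p c e x) :=
  isBoundedUnder_of ⟨0, fun e => h.stepFun_nonneg e x⟩

theorem antitone_limStep : Antitone (limStep p c) := fun x y hxy =>
  limsup_le_limsup (Eventually.of_forall fun e => h.antitone_stepFun e hxy)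
    (h.isBoundedUnder_ge y).isCoboundedUnder_le (h.isBoundedUnder_le x)

omit h in
theorem limStep_zero {L : ℝ} (hL : Tendsto (fun e => c e 0) atTop (𝓝 L)) :
    limStep p c 0 = L := by
  refine Tendsto.limsup_eq (hL.congr fun e => ?_)
  rw [stepFun, if_pos one_pos, zero_mul, Nat.floor_zero]

omit h in
theorem limStep_one {L : ℝ} (hL : Tendsto (fun e => c e (p ^ e - 1)) atTop (𝓝 L)) :
    limStep p c 1 = L := by
  refine Tendsto.limsup_eq (hL.congr fun e => ?_)
  rw [stepFun, if_neg (lt_irrefl _)]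

/-- At every finer level, x lies to the left of the interval refining the entry t = 1, and the first
entry of that refinement is at least c(e,1). The entry t = 0 would not serve: x may lie inside its
interval. -/
theorem le_limStep (e : ℕ) {x : ℝ} (hx : x * (p : ℝ) ^ e < 1) : c e 1 ≤ limStep p c x := by
  have hp := h.p_pos
  refine le_limsup_of_frequently_le (Eventually.frequently ?_) (h.isBoundedUnder_le x)
  filter_upwards [eventually_ge_atTop e] with e' he'
  obtain ⟨j, rfl⟩ := Nat.exists_eq_add_of_le he'
  have hpe : (1 : ℝ) ≤ (p : ℝ) ^ e := by exact_mod_cast h.one_le_pow e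
  have hx1 : x < 1 := by
    by_contra hge
    have := mul_le_mul (not_lt.mp hge) hpe zero_le_one (zero_le_one.trans (not_lt.mp hge))
    linarith
  rw [stepFun, if_pos hx1]
  refine (h.le_add e 1 j).trans (h.antitone _ (Nat.floor_le_of_le ?_))
  rw [mul_one, Nat.cast_pow, pow_add, ← mul_assoc]
  exact mul_le_of_le_one_left (pow_nonneg hp.le j) hx.le

theorem limStep_le {e : ℕ} (he : 1 ≤ e) {x : ℝ} (hx : (p : ℝ) ^ e - 1 ≤ x * (p : ℝ) ^ e) :
    limStep p c x ≤ c e (p ^ e - 2) := by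
  have hp := h.p_pos
  refine limsup_le_of_le (h.isBoundedUnder_ge x).isCoboundedUnder_le ?_
  filter_upwards [eventually_ge_atTop e] with e' he'
  obtain ⟨j, rfl⟩ := Nat.exists_eq_add_of_le he'
  -- Needed so that `p ^ e - 2` is not truncated.
  have h2 : 2 ≤ p ^ e := h.two_le.trans (Nat.le_self_pow (by omega) p)
  refine le_trans ?_ (h.add_le e (p ^ e - 2) j)
  rw [show p ^ e - 2 + 1 = p ^ e - 1 by omega, stepFun]
  split_ifs with hx1
  · refine h.antitone _ ((Nat.sub_le _ 1).trans (Nat.le_floor ?_))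
    rw [Nat.cast_mul, Nat.cast_sub (by omega), Nat.cast_pow, Nat.cast_pow, Nat.cast_one, pow_add,
      ← mul_assoc, mul_comm]
    exact mul_le_mul_of_nonneg_right hx (pow_nonneg hp.le j)
  · refine h.antitone _ (Nat.sub_le_sub_right ?_ 1)
    rw [pow_add, mul_comm]
    exact Nat.mul_le_mul_right _ (Nat.sub_le _ 1)

/-- Monotonicity gives the upper bound by the value at 0; the lower bound near 0 is c(e,1), which
tends to that same value. -/
theorem continuousWithinAt_limStep_zero : ContinuousWithinAt (limStep p c) (Icc 0 1) 0 := by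
  obtain ⟨L, hL⟩ := h.exists_tendsto_first
  rw [ContinuousWithinAt, limStep_zero hL]
  refine tendsto_order.mpr ⟨fun a ha => ?_, fun a ha => ?_⟩
  · obtain ⟨e, he⟩ := ((h.tendsto_second hL).eventually (lt_mem_nhds ha)).exists
    have hcont : ContinuousAt (fun x : ℝ => x * (p : ℝ) ^ e) 0 := by fun_prop
    have hev := hcont.eventually_lt_const (show (0 : ℝ) * (p : ℝ) ^ e < 1 by simp)
    filter_upwards [nhdsWithin_le_nhds hev] with x hx
    exact he.trans_le (h.le_limStep e hx)
  · filter_upwards [self_mem_nhdsWithin] with x hx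
    refine lt_of_le_of_lt (h.antitone_limStep hx.1) ?_
    rwa [limStep_zero hL]

theorem continuousWithinAt_limStep_one : ContinuousWithinAt (limStep p c) (Icc 0 1) 1 := by
  obtain ⟨L, hL⟩ := h.exists_tendsto_last
  rw [ContinuousWithinAt, limStep_one hL]
  refine tendsto_order.mpr ⟨fun a ha => ?_, fun a ha => ?_⟩
  · filter_upwards [self_mem_nhdsWithin] with x hx
    refine lt_of_lt_of_le ?_ (h.antitone_limStep hx.2)
    rwa [limStep_one hL]
  · obtain ⟨e, he, he1⟩ := (((h.tendsto_penultimate hL).eventually (gt_mem_nhds ha)).and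
      (eventually_ge_atTop 1)).exists
    have hcont : ContinuousAt (fun x : ℝ => x * (p : ℝ) ^ e) 1 := by fun_prop
    have hev := hcont.eventually_const_lt (show (p : ℝ) ^ e - 1 < 1 * (p : ℝ) ^ e by simp)
    filter_upwards [nhdsWithin_le_nhds hev] with x hx
    exact (h.limStep_le he1 hx.le).trans_lt he

theorem hasDerivWithinAt_integral_limStep {x : ℝ} (hx : x ∈ Icc (0 : ℝ) 1)
    (hc : ContinuousWithinAt (limStep p c) (Icc 0 1) x) :
    HasDerivWithinAt (fun y => ∫ t in (0 : ℝ)..y, limStep p c t) (limStep p c x) (Icc 0 1) x := by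
  -- This supplies the filter instance for the fundamental theorem of calculus within the closed
  -- interval, hence one-sided derivatives at its ends.
  have : Fact (x ∈ Icc (0 : ℝ) 1) := ⟨hx⟩
  exact intervalIntegral.integral_hasDerivWithinAt_right h.antitone_limStep.intervalIntegrable
    h.antitone_limStep.measurable.stronglyMeasurable.stronglyMeasurableAtFilter hc

theorem integrableOn_limStep : IntegrableOn (limStep p c) (Icc 0 1) volume :=
  (h.antitone_limStep.antitoneOn _).integrableOn_isCompact isCompact_Icc

end IsSlopeSequence

end SelfSimilar

/-! ### Hilbert-Kunz lengths of R/(f) as lengths over R. -/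

section HilbertKunz

theorem maximalIdeal_quotient_coe {R : Type*} [CommRing R] [IsLocalRing R] (I : Ideal R)
    [IsLocalRing (R ⧸ I)] :
    (IsLocalRing.maximalIdeal (R ⧸ I) : Set (R ⧸ I)) =
      Ideal.Quotient.mk I '' (IsLocalRing.maximalIdeal R : Set R) := by
  have hlocal := IsLocalHom.of_surjective (Ideal.Quotient.mk I) Ideal.Quotient.mk_surjective
  ext x
  obtain ⟨x, rfl⟩ := Ideal.Quotient.mk_surjective x
  constructor
  · intro hx
    exact ⟨x, fun h => hx (h.map _), rfl⟩
  · rintro ⟨y, hy, hyx⟩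
    rw [← hyx]
    exact fun h => hy (hlocal.map_nonunit y h)

theorem frobeniusPower_maximalIdeal_quotient {R : Type*} [CommRing R] [IsLocalRing R]
    (I : Ideal R) [IsLocalRing (R ⧸ I)] (q : ℕ) :
    frobeniusPower (IsLocalRing.maximalIdeal (R ⧸ I)) q =
      (frobeniusPower (IsLocalRing.maximalIdeal R) q).map (Ideal.Quotient.mk I) := by
  rw [frobeniusPower, frobeniusPower, Ideal.map_span, maximalIdeal_quotient_coe,
    Set.image_image, Set.image_image]
  simp only [map_pow]

theorem length_quotient_quotient {R : Type*} [CommRing R] (I J : Ideal R) :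
    Module.length (R ⧸ I) ((R ⧸ I) ⧸ J.map (Ideal.Quotient.mk I)) =
      Module.length R (R ⧸ I ⊔ J) := by
  rw [← Module.length_eq_of_surjective (S := R) (R := R ⧸ I) Ideal.Quotient.mk_surjective]
  exact (DoubleQuot.quotQuotEquivQuotSupₐ R I J).toLinearEquiv.length_eq

theorem length_M_add {R : Type*} [CommRing R] [IsLocalRing R] (p : ℕ) (f : R) (e t : ℕ) :
    Module.length R (R ⧸ powIdeal p f e (t + 1)) =
      Module.length R (M p f e t) + Module.length R (R ⧸ powIdeal p f e t) :=
  length_quotient_eq_add (powIdeal_succ_le p f e t)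

theorem powIdeal_zero {R : Type*} [CommRing R] [IsLocalRing R] (p : ℕ) (f : R) (e : ℕ) :
    powIdeal p f e 0 = ⊤ := by
  rw [powIdeal, pow_zero, Ideal.span_singleton_one, top_sup_eq]

/-- Both sides are the length of R/((f) + 𝔪^[p^e]), because the ideal for t = 0 is the whole ring.
-/
theorem length_hilbertKunz {R : Type*} [CommRing R] [IsLocalRing R] (p : ℕ) (f : R)
    [IsLocalRing (R ⧸ Ideal.span {f})] (e : ℕ) :
    Module.length (R ⧸ Ideal.span {f}) ((R ⧸ Ideal.span {f}) ⧸
        frobeniusPower (IsLocalRing.maximalIdeal (R ⧸ Ideal.span {f})) (p ^ e)) =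
      Module.length R (M p f e 0) := by
  have hsub : Subsingleton (R ⧸ powIdeal p f e 0) :=
    Ideal.Quotient.subsingleton_iff.mpr (powIdeal_zero p f e)
  have h : Module.length R (R ⧸ powIdeal p f e 1) = _ := length_M_add p f e 0
  rw [Module.length_eq_zero (M := R ⧸ powIdeal p f e 0), add_zero] at h
  rw [← h, frobeniusPower_maximalIdeal_quotient, length_quotient_quotient, powIdeal, pow_one]

end HilbertKunz

/-! ### The numbers C_{e,t} form a slope sequence. -/

section Hypersurface

variable {k : Type*} [Field k] [PerfectField k] (p : ℕ) [Fact p.Prime] [CharP k p]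

theorem hilbertKunzRatio_eq {k : Type*} [Field k] (p : ℕ) {n : ℕ}
    {f : MvPowerSeries (Fin (n + 1)) k} (hf0 : f ≠ 0)
    (hf : f ∈ IsLocalRing.maximalIdeal (MvPowerSeries (Fin (n + 1)) k))
    [IsLocalRing (MvPowerSeries (Fin (n + 1)) k ⧸ Ideal.span {f})] (e : ℕ) :
    hilbertKunzRatio p (MvPowerSeries (Fin (n + 1)) k ⧸ Ideal.span {f}) e = C p n f e 0 := by
  rw [hilbertKunzRatio, C, length_hilbertKunz, krullDimNat_hypersurface hf0 hf]

section

variable {σ : Type*} [Finite σ] (f : MvPowerSeries σ k)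

theorem finite_quotient_powIdeal (e t : ℕ) :
    Module.Finite k (MvPowerSeries σ k ⧸ powIdeal p f e t) := by
  have := (finite_and_finrank_quotient_frobeniusPower (k := k) (σ := σ) p e).1
  have hle : frobeniusPower (IsLocalRing.maximalIdeal (MvPowerSeries σ k)) (p ^ e) ≤
      powIdeal p f e t := le_sup_right
  exact Module.Finite.of_surjective (Ideal.Quotient.factorₐ k hle).toLinearMap
    (Ideal.Quotient.factor_surjective hle)

theorem length_quotient_powIdeal (e t : ℕ) :
    Module.length (MvPowerSeries σ k) (MvPowerSeries σ k ⧸ powIdeal p f e t) =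
      Module.finrank k (MvPowerSeries σ k ⧸ powIdeal p f e t) := by
  have := finite_quotient_powIdeal p f e t
  exact length_eq_finrank_of_residueField algebraMap_residueField_surjective

theorem length_M_ne_top (e t : ℕ) : Module.length (MvPowerSeries σ k) (M p f e t) ≠ ⊤ := by
  intro htop
  have h := length_M_add p f e t
  rw [htop, top_add, length_quotient_powIdeal] at h
  exact ENat.natCast_ne_top _ h

theorem finrank_powIdeal_succ (e t : ℕ) :
    Module.finrank k (MvPowerSeries σ k ⧸ powIdeal p f e (t + 1)) =
      (Module.length (MvPowerSeries σ k) (M p f e t)).toNat +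
        Module.finrank k (MvPowerSeries σ k ⧸ powIdeal p f e t) := by
  have h := length_M_add p f e t
  rw [length_quotient_powIdeal, length_quotient_powIdeal,
    ← ENat.natCast_toNat (length_M_ne_top p f e t)] at h
  exact_mod_cast h

theorem finrank_powIdeal_mul (e t : ℕ) :
    Module.finrank k (MvPowerSeries σ k ⧸ powIdeal p f (e + 1) (p * t)) =
      p ^ Nat.card σ * Module.finrank k (MvPowerSeries σ k ⧸ powIdeal p f e t) := by
  classical
  have := Fintype.ofFinite σ
  have := finite_quotient_powIdeal p f e t
  rw [← map_frobenius_powIdeal, finrank_quotient_map_frobenius]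

end

theorem C_eq (n : ℕ) {σ : Type*} [Finite σ] (f : MvPowerSeries σ k) (e t : ℕ) :
    C p n f e t = ((Module.finrank k (MvPowerSeries σ k ⧸ powIdeal p f e (t + 1)) : ℝ) -
      Module.finrank k (MvPowerSeries σ k ⧸ powIdeal p f e t)) / (p : ℝ) ^ (e * n) := by
  rw [C, finrank_powIdeal_succ, Nat.cast_add, add_sub_cancel_right]

/-- The sum telescopes to a difference of dimensions at level e + 1 with indices divisible by p.
Descending to level e contributes p^(n+1), the normalisation takes back p^n, and one factor p
remains. -/
theorem sum_C (n : ℕ) (f : MvPowerSeries (Fin (n + 1)) k) (e t : ℕ) :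
    ∑ s ∈ Finset.range p, C p n f (e + 1) (p * t + s) = p * C p n f e t := by
  have hp : (p : ℝ) ≠ 0 := Nat.cast_ne_zero.mpr (Fact.out : p.Prime).ne_zero
  rw [Finset.sum_congr rfl fun s _ => C_eq p n f (e + 1) (p * t + s), C_eq, ← Finset.sum_div]
  have htel : ∀ D : ℕ → ℝ, ∑ s ∈ Finset.range p, (D (p * t + s + 1) - D (p * t + s)) =
      D (p * (t + 1)) - D (p * t) := fun D => Finset.sum_range_sub (fun s => D (p * t + s)) p
  rw [htel fun s => (Module.finrank k
      (MvPowerSeries (Fin (n + 1)) k ⧸ powIdeal p f (e + 1) s) : ℝ),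
    finrank_powIdeal_mul, finrank_powIdeal_mul, Nat.card_eq_fintype_card, Fintype.card_fin]
  push_cast
  rw [add_mul e 1 n, one_mul, pow_add]
  field_simp
  ring

theorem exists_isSlopeSequence_C {n : ℕ} {f : MvPowerSeries (Fin (n + 1)) k} (hf0 : f ≠ 0) :
    ∃ K, IsSlopeSequence p (C p n f) K := by
  obtain ⟨K, hK⟩ := exists_finrank_le p hf0
  have hp : (0 : ℝ) < p := Nat.cast_pos.mpr (Fact.out : p.Prime).pos
  refine ⟨K, (Fact.out : p.Prime).two_le, fun e t => ?_, fun e => ?_, sum_C p n f, fun e => ?_⟩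
  · rw [C]
    positivity
  · refine antitone_nat_of_succ_le fun t => ?_
    rw [C, C]
    gcongr
    · exact length_M_ne_top p f e t
    · exact length_M_succ_le p f e t
  · rw [C_eq, div_le_iff₀ (pow_pos hp _)]
    have h1 : (Module.finrank k (MvPowerSeries (Fin (n + 1)) k ⧸ powIdeal p f e 1) : ℝ) ≤
        K * (p : ℝ) ^ (e * n) := by exact_mod_cast hK e
    exact (sub_le_self _ (Nat.cast_nonneg _)).trans h1

end Hypersurface

end HypersurfaceXi

end

theorem corollary2p5 {k : Type*} [Field k] [PerfectField k] (p : ℕ) [Fact p.Prime] [CharP k p]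
    (n : ℕ) (hn : 1 ≤ n) (f : MvPowerSeries (Fin (n + 1)) k) (hf0 : f ≠ 0)
    (hf : f ∈ IsLocalRing.maximalIdeal (MvPowerSeries (Fin (n + 1)) k)) :
    haveI : IsLocalRing (MvPowerSeries (Fin (n + 1)) k ⧸ Ideal.span {f}) :=
      HypersurfaceXi.isLocalRing_quotient hf
    -- the lengths, the limsup, the integral and the Hilbert-Kunz limit are well defined
    ((∀ e t : ℕ, Module.length (MvPowerSeries (Fin (n + 1)) k) (HypersurfaceXi.M p f e t) ≠ ⊤) ∧
      (∀ x ∈ Icc (0 : ℝ) 1,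
        IsBoundedUnder (· ≤ ·) atTop (fun e : ℕ => HypersurfaceXi.xiStep p n f e x)) ∧
      IntegrableOn (HypersurfaceXi.xi p n f) (Icc (0 : ℝ) 1) volume ∧
      Tendsto (HypersurfaceXi.hilbertKunzRatio p (MvPowerSeries (Fin (n + 1)) k ⧸ Ideal.span {f}))
        atTop (𝓝 (HypersurfaceXi.hilbertKunzMultiplicity p
          (MvPowerSeries (Fin (n + 1)) k ⧸ Ideal.span {f})))) ∧
    -- the endpoint 0
    (HasDerivWithinAt (HypersurfaceXi.phi p n f) (HypersurfaceXi.xi p n f 0) (Icc (0 : ℝ) 1) 0 ∧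
      Tendsto (fun e : ℕ => HypersurfaceXi.C p n f e 0) atTop (𝓝 (HypersurfaceXi.xi p n f 0)) ∧
      HypersurfaceXi.xi p n f 0 = HypersurfaceXi.hilbertKunzMultiplicity p
        (MvPowerSeries (Fin (n + 1)) k ⧸ Ideal.span {f})) ∧
    -- the endpoint 1
    (HasDerivWithinAt (HypersurfaceXi.phi p n f) (HypersurfaceXi.xi p n f 1) (Icc (0 : ℝ) 1) 1 ∧
      Tendsto (fun e : ℕ => HypersurfaceXi.C p n f e (p ^ e - 1)) atTop
        (𝓝 (HypersurfaceXi.xi p n f 1))) := by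
  have hloc : IsLocalRing (MvPowerSeries (Fin (n + 1)) k ⧸ Ideal.span {f}) :=
    HypersurfaceXi.isLocalRing_quotient hf
  obtain ⟨K, hC⟩ := HypersurfaceXi.exists_isSlopeSequence_C p hf0
  obtain ⟨L, hL⟩ := hC.exists_tendsto_first
  obtain ⟨L', hL'⟩ := hC.exists_tendsto_last
  -- `xi` is by definition `limStep` of the array `C p n f`, so the abstract results apply verbatim.
  have hxi0 : HypersurfaceXi.xi p n f 0 = L := HypersurfaceXi.IsSlopeSequence.limStep_zero hL
  have hxi1 : HypersurfaceXi.xi p n f 1 = L' := HypersurfaceXi.IsSlopeSequence.limStep_one hL'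
  have hHK : Tendsto (HypersurfaceXi.hilbertKunzRatio p
      (MvPowerSeries (Fin (n + 1)) k ⧸ Ideal.span {f})) atTop (𝓝 L) :=
    hL.congr fun e => (HypersurfaceXi.hilbertKunzRatio_eq p hf0 hf e).symm
  have hlim : HypersurfaceXi.hilbertKunzMultiplicity p
      (MvPowerSeries (Fin (n + 1)) k ⧸ Ideal.span {f}) = L := hHK.limUnder_eq
  refine ⟨⟨HypersurfaceXi.length_M_ne_top p f, fun x _ => hC.isBoundedUnder_le x,
    hC.integrableOn_limStep, ?_⟩, ⟨?_, ?_, ?_⟩, ?_, ?_⟩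
  · rw [hlim]
    exact hHK
  · exact hC.hasDerivWithinAt_integral_limStep (left_mem_Icc.mpr zero_le_one)
      hC.continuousWithinAt_limStep_zero
  · rw [hxi0]
    exact hL
  · rw [hxi0, hlim]
  · exact hC.hasDerivWithinAt_integral_limStep (right_mem_Icc.mpr zero_le_one)
      hC.continuousWithinAt_limStep_one
  · rw [hxi1]
    exact hL'
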